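/- **Theorem 5.1 (KPT-type theorem for Fraïssé structures).** *Definitions.* Let $\mathfrak X$ be a Fraïssé structure, i.e. a countable (possibly finite) structure in a relational language which is ultrahomogeneous: every embedding of a finite substructure of $\mathfrak X$ into $\mathfrak X$ extends to an automorphism of $\mathfrak X$. Let $\operatorname{Age}(\mathfrak X)$ be the collection of finite substructures of $\mathfrak X$. For structures $\mathfrak A,\mathfrak B$ in the same language, $\binom{\mathfrak B}{\mathfrak A}$ denotes the set of embeddings of $\mathfrak A$ into $\mathfrak B$, and $\left\langle{\mathfrak B\atop\mathfrak A}\right\rangle$ the set of finitely supported probability measures on $\binom{\mathfrak B}{\mathfrak A}$, viewed as formal convex combinations $\sum_j\lambda_j\alpha_j$ in the real vector space freely generated by $\binom{\mathfrak B}{\mathfrak A}$. Composition of embeddings is extended bilinearly to these vector spaces, and for $\beta\in\left\langle{\mathfrak C\atop\mathfrak B}\right\rangle$ we put $\left\langle{\beta\atop\mathfrak A}\right\rangle=\{\beta\circ\alpha:\alpha\in\left\langle{\mathfrak B\atop\mathfrak A}\right\rangle\}\subseteq\left\langle{\mathfrak C\atop\mathfrak A}\right\rangle$. A real-valued function $f$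 on $\binom{\mathfrak C}{\mathfrak A}$ is extended linearly to the vector space generated by $\binom{\mathfrak C}{\mathfrak A}$. For $k\in\mathbb N$, $\mathfrak C\to\langle\mathfrak B\rangle^{\mathfrak A}_k$ means: for every $f:\binom{\mathfrak C}{\mathfrak A}\to\{0,\dots,k-1\}$ there is $\beta\in\left\langle{\mathfrak C\atop\mathfrak B}\right\rangle$ such that $|f(\alpha)-f(\alpha')|\le\frac12$ for all $\alpha,\alpha'\in\left\langle{\beta\atop\mathfrak A}\right\rangle$. The group $\operatorname{Aut}(\mathfrak X)$ carries the topology of pointwise convergence on the discrete set $\mathfrak X$. A topological group $G$ is amenable if for every (jointly) continuous action of $G$ on a nonempty compact Hausdorff space $K$ there is a $G$-invariant (countably additive) Borel probability measure on $K$. *Statement.* If $\mathfrak X$ is a Fraïssé structure, then the following are equivalent: 1. for every $\mathfrak A,\mathfrak B\in\operatorname{Age}(\mathfrak X)$ and every $f:\binom{\mathfrak X}{\mathfrak A}\to\{0,1\}$ there is $\beta\in\left\langle{\mathfrak X\atop\mathfrak B}\right\rangle$ such that $|f(\alpha)-f(\alpha')|\le\frac12$ for all $\alpha,\alpha'\in\left\langle{\beta\atop\mathfrak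 A}\right\rangle$; 2. $\operatorname{Age}(\mathfrak X)$ has the convex Ramsey property: for every $\mathfrak A,\mathfrak B\in\operatorname{Age}(\mathfrak X)$ there is $\mathfrak C\in\operatorname{Age}(\mathfrak X)$ such that $\mathfrak C\to\langle\mathfrak B\rangle^{\mathfrak A}_2$; 3. there is $p<1$ such that for every $\mathfrak A,\mathfrak B\in\operatorname{Age}(\mathfrak X)$ there is $\mathfrak C\in\operatorname{Age}(\mathfrak X)$ such that for every $f:\binom{\mathfrak C}{\mathfrak A}\to[0,1]$ there is $\beta\in\left\langle{\mathfrak C\atop\mathfrak B}\right\rangle$ such that $|f(\alpha)-f(\alpha')|\le p$ for all $\alpha,\alpha'\in\left\langle{\beta\atop\mathfrak A}\right\rangle$; 4. for every $\mathfrak A,\mathfrak B\in\operatorname{Age}(\mathfrak X)$ and every $\varepsilon>0$ there is $\mathfrak C\in\operatorname{Age}(\mathfrak X)$ such that for every $f:\binom{\mathfrak C}{\mathfrak A}\to[0,1]$ there is $\beta\in\left\langle{\mathfrak C\atop\mathfrak B}\right\rangle$ such that $|f(\alpha)-f(\alpha')|\le\varepsilon$ for all $\alpha,\alpha'\in\left\langle{\beta\atop\mathfrak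 A}\right\rangle$; 5. for every $\mathfrak A,\mathfrak B\in\operatorname{Age}(\mathfrak X)$, every $\varepsilon>0$ and every $n\in\mathbb N$ there is $\mathfrak C\in\operatorname{Age}(\mathfrak X)$ such that for every sequence $f_i$ $(i<n)$ of functions from $\binom{\mathfrak C}{\mathfrak A}$ to $[0,1]$ there is $\beta\in\left\langle{\mathfrak C\atop\mathfrak B}\right\rangle$ such that $|f_i(\alpha)-f_i(\alpha')|\le\varepsilon$ for all $i<n$ and all $\alpha,\alpha'\in\left\langle{\beta\atop\mathfrak A}\right\rangle$; 6. the topological group $\operatorname{Aut}(\mathfrak X)$ is amenable. -/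

import Mathlib

universe u v w x

open scoped FirstOrder

namespace ConvexRamsey

open FirstOrder FirstOrder.Language

/-! ### The automorphism group of a first-order structure, as a topological group -/

section Automorphisms

variable {L : FirstOrder.Language.{u, v}} {M : Type w} [L.Structure M]

/-- The automorphisms of `M` form a group under composition. -/
instance autGroup : Group (M ≃[L] M) where
  mul g h := g.comp h
  one := FirstOrder.Language.Equiv.refl L M
  inv g := g.symm
  mul_assoc _ _ _ := rfl
  one_mul _ := rfl
  mul_one _ := rfl
  inv_mul_cancel g := FirstOrder.Language.Equiv.symm_comp_self g

/-- The topology of pointwise convergence on `Aut(M)`, where `M` is discrete. -/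
instance autTopology : TopologicalSpace (M ≃[L] M) :=
  TopologicalSpace.induced (fun g => (g : M → M))
    (@Pi.topologicalSpace M (fun _ => M) (fun _ => ⊥))

theorem aut_mul_apply (g h : M ≃[L] M) (a : M) : (g * h) a = g (h a) := rfl

theorem aut_inv_apply_eq_iff (g : M ≃[L] M) (a b : M) : g⁻¹ a = b ↔ g b = a := by
  constructor
  · rintro rfl
    exact g.apply_symm_apply a
  · rintro rfl
    exact g.symm_apply_apply b

/-- The sets `{g | g a = b}` are open. -/
theorem aut_isOpen_apply_eq (a b : M) : IsOpen {g : M ≃[L] M | g a = b} := by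
  let _ : TopologicalSpace M := ⊥
  have _ : DiscreteTopology M := ⟨rfl⟩
  have h : Continuous (fun g : M ≃[L] M => (g : M → M)) := continuous_induced_dom
  exact (isOpen_discrete ({b} : Set M)).preimage ((continuous_apply a).comp h)

/-- A map into `Aut(M)` is continuous as soon as the preimages of the sets `{g | g a = b}`
are open. -/
theorem aut_continuous_of {T : Type x} [TopologicalSpace T] {F : T → (M ≃[L] M)}
    (h : ∀ a b, IsOpen {t | F t a = b}) : Continuous F := by
  let _ : TopologicalSpace M := ⊥
  have _ : DiscreteTopology M := ⟨rfl⟩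
  refine continuous_induced_rng.2 (continuous_pi fun a => ?_)
  refine continuous_discrete_rng.2 fun b => ?_
  exact h a b

instance autIsTopologicalGroup : IsTopologicalGroup (M ≃[L] M) where
  continuous_mul := by
    refine aut_continuous_of fun a b => ?_
    have : {p : (M ≃[L] M) × (M ≃[L] M) | (p.1 * p.2) a = b} =
        ⋃ c : M, {g : M ≃[L] M | g c = b} ×ˢ {g : M ≃[L] M | g a = c} := by
      ext p
      simp [aut_mul_apply]
    rw [this]
    exact isOpen_iUnion fun c => (aut_isOpen_apply_eq c b).prod (aut_isOpen_apply_eq a c)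
  continuous_inv := by
    refine aut_continuous_of fun a b => ?_
    simp only [aut_inv_apply_eq_iff]
    exact aut_isOpen_apply_eq b a

end Automorphisms

/-- A topological group `G` is amenable if every continuous action of `G` on a nonempty compact
Hausdorff space preserves a Borel probability measure. The universe of the spaces is a
parameter. -/
def IsAmenable (G : Type w) [Group G] [TopologicalSpace G] [IsTopologicalGroup G] : Prop :=
  ∀ (K : Type x) [TopologicalSpace K] [CompactSpace K] [T2Space K] [Nonempty K]
    [MulAction G K] [ContinuousSMul G K] [MeasurableSpace K] [BorelSpace K],
    ∃ μ : MeasureTheory.Measure K,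
      MeasureTheory.IsProbabilityMeasure μ ∧ MeasureTheory.SMulInvariantMeasure G K μ

/-! ### Convex combinations of embeddings -/

/-- The age of a structure `M` in a relational language: its finite substructures. -/
def Age (L : FirstOrder.Language.{u, v}) (M : Type w) [L.Structure M] : Set (L.Substructure M) :=
  {A | (A : Set M).Finite}

noncomputable section

variable {L : FirstOrder.Language.{u, v}} {A B C : Type w}
  [L.Structure A] [L.Structure B] [L.Structure C]

/-- The finitely supported probability measures on the set of embeddings of `A` into `B`, as a
subset of the real vector space freely generated by these embeddings. -/
def convexEmb (L : FirstOrder.Language.{u, v}) (B A : Type w) [L.Structure B] [L.Structure A] :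
    Set ((A ↪[L] B) →₀ ℝ) :=
  {m | (∀ e, 0 ≤ m e) ∧ (m.sum fun _ r => r) = 1}

/-- The bilinear extension of the composition of embeddings. -/
def compLin (β : (B ↪[L] C) →₀ ℝ) (α : (A ↪[L] B) →₀ ℝ) : (A ↪[L] C) →₀ ℝ :=
  β.sum fun b r => α.sum fun a s => Finsupp.single (b.comp a) (r * s)

/-- The set of all `β ∘ α`, where `α` is a finitely supported probability measure on the
embeddings of `A` into `B`. -/
def convexCopies (A : Type w) [L.Structure A] (β : (B ↪[L] C) →₀ ℝ) : Set ((A ↪[L] C) →₀ ℝ) :=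
  compLin β '' convexEmb L B A

/-- The linear extension of a function on embeddings to the free vector space. -/
def linExt (f : (A ↪[L] C) → ℝ) (α : (A ↪[L] C) →₀ ℝ) : ℝ :=
  α.sum fun e r => r * f e

/-- The linear extension of `f` varies by at most `ε` on the convex copies of `A` given by `β`. -/
def IsBalanced (f : (A ↪[L] C) → ℝ) (β : (B ↪[L] C) →₀ ℝ) (ε : ℝ) : Prop :=
  ∀ α ∈ convexCopies A β, ∀ α' ∈ convexCopies A β, |linExt f α - linExt f α'| ≤ ε

/-- The relation `C → ⟨B⟩^A_k`: for every colouring `f` of the embeddings of `A` into `C` by the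
numbers `0, …, k - 1` there is a convex combination of embeddings of `B` into `C` on which `f`
varies by at most `1/2`. -/
def ConvexArrow (L : FirstOrder.Language.{u, v}) (C B A : Type w)
    [L.Structure C] [L.Structure B] [L.Structure A] (k : ℕ) : Prop :=
  ∀ f : (A ↪[L] C) → Fin k, ∃ β ∈ convexEmb L C B,
    IsBalanced (fun e => ((f e : ℕ) : ℝ)) β (1 / 2)

/-- The convex Ramsey property of the age of `M`. -/
def ConvexRamseyProperty (L : FirstOrder.Language.{u, v}) (M : Type w) [L.Structure M] : Prop :=
  ∀ A ∈ Age L M, ∀ B ∈ Age L M, ∃ C ∈ Age L M, ConvexArrow L C B A 2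

end

end ConvexRamsey

/-! The implications proved are 1 → 3 → 4 → 5 → 6 → 1 and 4 → 2 → 1. Averaging `f` over `β` gives a
function `push f β` on the copies of `A` in `B`, and `β` balances `f` exactly when this function
oscillates little (`isBalanced_iff`). Composing combinations iterates `push` (`push_compLin`), so
balancing can be done in stages: rescaling between stages improves a bound `p < 1` to `p ^ n`, and
treating one function per stage balances finitely many at once. Rounding handles `[0, 1]`-valued
functions by colourings, and an ultrafilter limit replaces `M` by a finite substructure.

From balancing to amenability: fix `y₀ ∈ K` and let `Λ h` be the `β`-average of `h (g_b⁻¹ • y₀)`,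
with `g_b` an automorphism extending `b`. By continuity, `h (g⁻¹ • y₀)` depends, up to a small
error, only on the restriction of `g` to a finite `A`. Translating `h` then means passing to another
copy of `A` in `B`, which a balanced `β` barely notices. A limit of such `Λ` is an invariant
functional, hence by Riesz an invariant measure.

From amenability to balancing: take an invariant measure on the orbit closure of `f`. Since `Aut(M)`
is transitive on embeddings of `A`, the integral of `k e` over `k` does not depend on `e`.
Restricted to copies of `A` in `B`, this constant function is the barycentre of a measure on the
closure of the convex set of all `push f β`, so some `push f β` is nearly constant. -/

namespace ConvexRamsey

open FirstOrder FirstOrder.Language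

/-! ### Calculus of convex combinations of embeddings -/

section Push

variable {L : FirstOrder.Language.{u, v}} {A B C D : Type w}
  [L.Structure A] [L.Structure B] [L.Structure C] [L.Structure D]

/-- The function on the embeddings of `A` into `B` obtained by composing `f` with a formal
combination `β` of embeddings of `B` into `C`. -/
noncomputable def push (f : (A ↪[L] C) → ℝ) (β : (B ↪[L] C) →₀ ℝ) (a : A ↪[L] B) : ℝ :=
  linExt (fun b => f (b.comp a)) β

theorem linExt_eq_sum (f : (A ↪[L] C) → ℝ) (α : (A ↪[L] C) →₀ ℝ) :
    linExt f α = ∑ e ∈ α.support, α e * f e := rfl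

theorem linExt_single (f : (A ↪[L] C) → ℝ) (e : A ↪[L] C) (r : ℝ) :
    linExt f (Finsupp.single e r) = r * f e := by
  simp [linExt]

theorem linExt_sum {ι : Type*} (s : Finset ι) (f : (A ↪[L] C) → ℝ) (α : ι → (A ↪[L] C) →₀ ℝ) :
    linExt f (∑ i ∈ s, α i) = ∑ i ∈ s, linExt f (α i) :=
  (Finsupp.sum_finsetSum_index (by simp) (by intros; ring)).symm

theorem linExt_add (f : (A ↪[L] C) → ℝ) (α α' : (A ↪[L] C) →₀ ℝ) :
    linExt f (α + α') = linExt f α + linExt f α' :=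
  Finsupp.sum_add_index' (by simp) (by intros; ring)

theorem linExt_smul (f : (A ↪[L] C) → ℝ) (r : ℝ) (α : (A ↪[L] C) →₀ ℝ) :
    linExt f (r • α) = r * linExt f α := by
  unfold linExt
  rw [Finsupp.sum_smul_index' (by simp), Finsupp.mul_sum]
  simp [mul_assoc]

theorem linExt_compLin (f : (A ↪[L] C) → ℝ) (β : (B ↪[L] C) →₀ ℝ) (α : (A ↪[L] B) →₀ ℝ) :
    linExt f (compLin β α) = linExt (push f β) α := by
  unfold compLin
  simp only [Finsupp.sum, linExt_sum, linExt_single]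
  rw [Finset.sum_comm]
  simp only [linExt_eq_sum, push, Finset.mul_sum]
  refine Finset.sum_congr rfl fun a _ => Finset.sum_congr rfl fun b _ => ?_
  ring

theorem push_compLin (f : (A ↪[L] D) → ℝ) (γ : (C ↪[L] D) →₀ ℝ) (β : (B ↪[L] C) →₀ ℝ) :
    push f (compLin γ β) = push (push f γ) β := by
  funext a
  exact linExt_compLin _ γ β

theorem push_single_one (f : (A ↪[L] C) → ℝ) (b : B ↪[L] C) (a : A ↪[L] B) :
    push f (Finsupp.single b 1) a = f (b.comp a) := by
  simp [push, linExt_single]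

theorem sum_eq_linExt_one (α : (A ↪[L] C) →₀ ℝ) :
    (α.sum fun _ r => r) = linExt (fun _ => 1) α := by
  simp [linExt]

theorem mem_convexEmb_iff {α : (A ↪[L] C) →₀ ℝ} :
    α ∈ convexEmb L C A ↔ (∀ e, 0 ≤ α e) ∧ linExt (fun _ => 1) α = 1 := by
  rw [convexEmb, Set.mem_ofPred_eq, sum_eq_linExt_one]

theorem single_mem_convexEmb (e : A ↪[L] C) : Finsupp.single e 1 ∈ convexEmb L C A := by
  classical
  refine mem_convexEmb_iff.2 ⟨fun e' => ?_, by simp [linExt_single]⟩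
  rw [Finsupp.single_apply]
  split_ifs <;> norm_num

theorem convex_convexEmb : Convex ℝ (convexEmb L C A) := by
  intro α hα β hβ r s hr hs hrs
  rw [mem_convexEmb_iff] at *
  refine ⟨fun e => ?_, by rw [linExt_add, linExt_smul, linExt_smul, hα.2, hβ.2]; simpa using hrs⟩
  have := mul_nonneg hr (hα.1 e)
  have := mul_nonneg hs (hβ.1 e)
  simpa using by positivity

theorem compLin_mem_convexEmb {β : (B ↪[L] C) →₀ ℝ} {α : (A ↪[L] B) →₀ ℝ}
    (hβ : β ∈ convexEmb L C B) (hα : α ∈ convexEmb L B A) : compLin β α ∈ convexEmb L C A := by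
  classical
  rw [mem_convexEmb_iff] at *
  refine ⟨fun e => ?_, ?_⟩
  · simp only [compLin, Finsupp.sum, Finsupp.finsetSum_apply, Finsupp.single_apply]
    refine Finset.sum_nonneg fun b _ => Finset.sum_nonneg fun a _ => ?_
    split_ifs
    · exact mul_nonneg (hβ.1 b) (hα.1 a)
    · rfl
  · rw [linExt_compLin]
    have : push (fun _ : A ↪[L] C => (1 : ℝ)) β = fun _ => 1 := funext fun _ => hβ.2
    rw [this, hα.2]

theorem linExt_mono {f g : (A ↪[L] C) → ℝ} {α : (A ↪[L] C) →₀ ℝ} (hα : ∀ e, 0 ≤ α e)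
    (h : ∀ e, f e ≤ g e) : linExt f α ≤ linExt g α :=
  Finset.sum_le_sum fun e _ => mul_le_mul_of_nonneg_left (h e) (hα e)

theorem linExt_affine (f : (A ↪[L] C) → ℝ) {α : (A ↪[L] C) →₀ ℝ} (hα : α ∈ convexEmb L C A)
    (c d : ℝ) : linExt (fun e => c * f e + d) α = c * linExt f α + d := by
  have h : linExt (fun _ => 1) α = 1 := (mem_convexEmb_iff.1 hα).2
  simp only [linExt_eq_sum, mul_one] at *
  simp only [mul_add, Finset.sum_add_distrib, ← Finset.sum_mul, h, one_mul, Finset.mul_sum]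
  congr 1
  exact Finset.sum_congr rfl fun e _ => by ring

theorem linExt_const {α : (A ↪[L] C) →₀ ℝ} (hα : α ∈ convexEmb L C A) (d : ℝ) :
    linExt (fun _ => d) α = d := by
  simpa using linExt_affine (fun _ => 0) hα 0 d

theorem linExt_sub (f g : (A ↪[L] C) → ℝ) (α : (A ↪[L] C) →₀ ℝ) :
    linExt f α - linExt g α = linExt (fun e => f e - g e) α := by
  simp only [linExt_eq_sum, mul_sub, Finset.sum_sub_distrib]

theorem linExt_mem_Icc {f : (A ↪[L] C) → ℝ} {α : (A ↪[L] C) →₀ ℝ} (hα : α ∈ convexEmb L C A)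
    {c d : ℝ} (h : ∀ e, f e ∈ Set.Icc c d) : linExt f α ∈ Set.Icc c d := by
  have h0 := (mem_convexEmb_iff.1 hα).1
  exact ⟨(linExt_const hα c).symm.trans_le (linExt_mono h0 fun e => (h e).1),
    (linExt_mono h0 fun e => (h e).2).trans_eq (linExt_const hα d)⟩

theorem abs_linExt_sub_le {f g : (A ↪[L] C) → ℝ} {α : (A ↪[L] C) →₀ ℝ}
    (hα : α ∈ convexEmb L C A) {ε : ℝ} (h : ∀ e, |f e - g e| ≤ ε) :
    |linExt f α - linExt g α| ≤ ε := by
  rw [linExt_sub, abs_le]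
  exact linExt_mem_Icc hα fun e => abs_le.1 (h e)

theorem push_mem_Icc {f : (A ↪[L] C) → ℝ} {β : (B ↪[L] C) →₀ ℝ} (hβ : β ∈ convexEmb L C B)
    {c d : ℝ} (h : ∀ e, f e ∈ Set.Icc c d) (a : A ↪[L] B) : push f β a ∈ Set.Icc c d :=
  linExt_mem_Icc hβ fun _ => h _

theorem push_affine (f : (A ↪[L] C) → ℝ) {β : (B ↪[L] C) →₀ ℝ} (hβ : β ∈ convexEmb L C B)
    (c d : ℝ) (a : A ↪[L] B) : push (fun e => c * f e + d) β a = c * push f β a + d :=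
  linExt_affine (fun b => f (b.comp a)) hβ c d

/-- Averages stay inside an interval, so an interval is handier than a pairwise bound; `c` is the
infimum of `g`. -/
theorem exists_forall_mem_Icc_of_abs_sub_le {T : Type*} {g : T → ℝ} {r : ℝ}
    (h : ∀ s t, |g s - g t| ≤ r) : ∃ c, ∀ t, g t ∈ Set.Icc c (c + r) := by
  have hb : BddBelow (Set.range g) := by
    rcases isEmpty_or_nonempty T with hT | ⟨⟨t⟩⟩
    · simp
    · refine ⟨g t - r, ?_⟩
      rintro _ ⟨s, rfl⟩
      linarith [(abs_le.1 (h s t)).1]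
  refine ⟨⨅ t, g t, fun t => ⟨ciInf_le hb t, ?_⟩⟩
  have : Nonempty T := ⟨t⟩
  have : g t - r ≤ ⨅ t, g t := le_ciInf fun s => by linarith [(abs_le.1 (h t s)).2]
  linarith

/-- It suffices to test balancedness on embeddings. -/
theorem isBalanced_iff {f : (A ↪[L] C) → ℝ} {β : (B ↪[L] C) →₀ ℝ} {ε : ℝ} :
    IsBalanced f β ε ↔ ∀ a a' : A ↪[L] B, |push f β a - push f β a'| ≤ ε := by
  constructor
  · intro h a a'
    simpa [linExt_compLin, linExt_single] using
      h _ ⟨_, single_mem_convexEmb a, rfl⟩ _ ⟨_, single_mem_convexEmb a', rfl⟩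
  · rintro h _ ⟨α, hα, rfl⟩ _ ⟨α', hα', rfl⟩
    obtain ⟨c, hc⟩ := exists_forall_mem_Icc_of_abs_sub_le h
    rw [linExt_compLin, linExt_compLin]
    have h1 := linExt_mem_Icc hα hc
    have h2 := linExt_mem_Icc hα' hc
    rw [abs_le]
    constructor <;> linarith [h1.1, h1.2, h2.1, h2.2]

/-- Each `b` in the support of `β` carries `a` and `a'` to embeddings into `C` on which `push f γ`
differs by at most `ε`; averaging over `b` keeps the bound. Later stages thus preserve what earlier
stages achieved. -/
theorem IsBalanced.compLin {f : (A ↪[L] D) → ℝ} {γ : (C ↪[L] D) →₀ ℝ} {β : (B ↪[L] C) →₀ ℝ}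
    {ε : ℝ} (h : IsBalanced f γ ε) (hβ : β ∈ convexEmb L C B) :
    IsBalanced f (compLin γ β) ε := by
  rw [isBalanced_iff] at *
  intro a a'
  rw [push_compLin]
  exact abs_linExt_sub_le hβ fun e => h _ _

theorem isBalanced_compLin_iff {f : (A ↪[L] D) → ℝ} {γ : (C ↪[L] D) →₀ ℝ}
    {β : (B ↪[L] C) →₀ ℝ} {ε : ℝ} :
    IsBalanced f (ConvexRamsey.compLin γ β) ε ↔ IsBalanced (push f γ) β ε := by
  simp only [isBalanced_iff, push_compLin]

theorem IsBalanced.mono {f : (A ↪[L] C) → ℝ} {β : (B ↪[L] C) →₀ ℝ} {ε δ : ℝ}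
    (h : IsBalanced f β ε) (hεδ : ε ≤ δ) : IsBalanced f β δ :=
  fun α hα α' hα' => (h α hα α' hα').trans hεδ

theorem isBalanced_one {f : (A ↪[L] C) → ℝ} {β : (B ↪[L] C) →₀ ℝ} (hβ : β ∈ convexEmb L C B)
    (hf : ∀ e, f e ∈ Set.Icc (0 : ℝ) 1) : IsBalanced f β 1 := by
  rw [isBalanced_iff]
  intro a a'
  have h1 := push_mem_Icc hβ hf a
  have h2 := push_mem_Icc hβ hf a'
  rw [abs_le]
  constructor <;> linarith [h1.1, h1.2, h2.1, h2.2]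

/-- Balancedness of a rescaled function. -/
theorem isBalanced_of_affine {f : (A ↪[L] C) → ℝ} {β : (B ↪[L] C) →₀ ℝ}
    (hβ : β ∈ convexEmb L C B) {c d ε : ℝ} (hc : 0 < c)
    (h : IsBalanced (fun e => c * f e + d) β (c * ε)) : IsBalanced f β ε := by
  rw [isBalanced_iff] at *
  intro a a'
  have := h a a'
  rw [push_affine f hβ, push_affine f hβ, add_sub_add_right_eq_sub, ← mul_sub, abs_mul,
    abs_of_pos hc] at this
  exact le_of_mul_le_mul_left this hc

end Push

/-! ### Compactness, rounding and iteration -/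

section FiniteCombinatorics

open Filter Topology

variable {L : FirstOrder.Language.{u, v}}

/-- Every `[0, 1]`-valued function on the embeddings of `A` into `C` is balanced up to `ε` by a
convex combination of embeddings of `B` into `C`. -/
def BalancedArrow (L : FirstOrder.Language.{u, v}) (C B A : Type w)
    [L.Structure C] [L.Structure B] [L.Structure A] (ε : ℝ) : Prop :=
  ∀ f : (A ↪[L] C) → ℝ, (∀ e, f e ∈ Set.Icc (0 : ℝ) 1) →
    ∃ β ∈ convexEmb L C B, IsBalanced f β ε

theorem finite_embedding (A B : Type w) [L.Structure A] [L.Structure B] [Finite A] [Finite B] :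
    Finite (A ↪[L] B) :=
  Finite.of_injective (fun e : A ↪[L] B => (e : A → B)) DFunLike.coe_injective

theorem compLin_single_one {A B C : Type w} [L.Structure A] [L.Structure B] [L.Structure C]
    (j : B ↪[L] C) (α : (A ↪[L] B) →₀ ℝ) :
    compLin (Finsupp.single j 1) α = α.mapDomain j.comp := by
  unfold compLin
  rw [Finsupp.sum_single_index (by simp)]
  simp [Finsupp.mapDomain]

/-- In a relational language the closure adds no points. -/
theorem Age.closure_mem {M : Type w} [L.Structure M] [L.IsRelational] {s : Set M}
    (hs : s.Finite) : Substructure.closure L s ∈ Age L M := by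
  change Set.Finite _
  rwa [Substructure.closure_eq_of_isRelational]

/-- A convex combination of embeddings into `M` with images in `C` comes from `C`. -/
theorem exists_compLin_subtype_eq {B M : Type w} [L.Structure B] [L.Structure M]
    {β : (B ↪[L] M) →₀ ℝ} (hβ : β ∈ convexEmb L M B) (C : L.Substructure M)
    (h : ∀ b ∈ β.support, ∀ x, b x ∈ C) :
    ∃ β' ∈ convexEmb L C B, compLin (Finsupp.single C.subtype 1) β' = β := by
  have hinj : Function.Injective (C.subtype.comp : (B ↪[L] C) → (B ↪[L] M)) := by
    intro e e' hee
    ext x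
    exact DFunLike.congr_fun hee x
  have heq : compLin (Finsupp.single C.subtype 1) (β.comapDomain _ hinj.injOn) = β := by
    rw [compLin_single_one, Finsupp.mapDomain_comapDomain _ hinj]
    intro b hb
    exact ⟨b.codRestrict C (h b hb), by ext; rfl⟩
  refine ⟨_, mem_convexEmb_iff.2 ⟨fun e => ?_, ?_⟩, heq⟩
  · exact hβ.1 _
  · have := (mem_convexEmb_iff.1 hβ).2
    rw [← heq, linExt_compLin] at this
    refine Eq.trans ?_ this
    congr 1
    funext e
    exact (push_single_one (fun _ : B ↪[L] M => (1 : ℝ)) C.subtype e).symm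

/-- Compactness: balancedness for functions on the embeddings into `M` passes to a finite
substructure, at the cost of an arbitrarily small error. -/
theorem exists_balancedArrow_of_lt {M : Type w} [L.Structure M] [L.IsRelational]
    {A B : Type w} [L.Structure A] [L.Structure B] [Finite A] [Finite B] {r p : ℝ} (hrp : r < p)
    (h : BalancedArrow L M B A r) : ∃ C ∈ Age L M, BalancedArrow L C B A p := by
  classical
  by_contra! hno
  have hC : ∀ s : Finset M, Substructure.closure L (s : Set M) ∈ Age L M :=
    fun s => Age.closure_mem s.finite_toSet
  have hbad : ∀ s : Finset M, ∃ f : (A ↪[L] Substructure.closure L (s : Set M)) → ℝ,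
      (∀ e, f e ∈ Set.Icc (0 : ℝ) 1) ∧
      ∀ β ∈ convexEmb L (Substructure.closure L (s : Set M)) B, ¬ IsBalanced f β p := by
    intro s
    simpa [BalancedArrow] using hno _ (hC s)
  choose f hf hfb using hbad
  let F : Finset M → (A ↪[L] M) → ℝ := fun s e =>
    if h : ∀ x, e x ∈ Substructure.closure L (s : Set M) then f s (e.codRestrict _ h) else 0
  have hF : ∀ s e, F s e ∈ Set.Icc (0 : ℝ) 1 := by
    intro s e
    by_cases h : ∀ x, e x ∈ Substructure.closure L (s : Set M)
    · simpa only [F, dif_pos h] using hf s _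
    · simp only [F, dif_neg h]
      simp
  have hFsub : ∀ s e, F s ((Substructure.closure L (s : Set M)).subtype.comp e) = f s e := by
    intro s e
    exact dif_pos fun x => (e x).2
  let U : Ultrafilter (Finset M) := Ultrafilter.of atTop
  -- By Tychonoff, the counterexamples `F s` have a pointwise limit `G` along `U`. Balancing `G`
  -- will balance some `F s`, because only finitely many embeddings matter.
  obtain ⟨G, hG, hlim⟩ := (isCompact_univ_pi fun _ : A ↪[L] M =>
    isCompact_Icc (a := (0 : ℝ)) (b := 1)).ultrafilter_le_nhds' (U.map F)
      (Filter.mem_map.2 (Filter.univ_mem' fun s e _ => hF s e))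
  have hlim : Tendsto F U (𝓝 G) := hlim
  obtain ⟨β, hβ, hbal⟩ := h G fun e => hG e trivial
  have hpush : ∀ a : A ↪[L] B, Tendsto (fun s => push (F s) β a) U (𝓝 (push G β a)) := by
    intro a
    simp only [push, linExt_eq_sum]
    exact tendsto_finsetSum _ fun b _ => (tendsto_pi_nhds.1 hlim _).const_mul _
  have := finite_embedding (L := L) A B
  have h1 : ∀ᶠ s in (U : Filter (Finset M)), ∀ a, |push (F s) β a - push G β a| < (p - r) / 2 := by
    refine Filter.eventually_all.2 fun a => ?_
    exact Metric.tendsto_nhds.1 (hpush a) _ (by linarith)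
  let T : Finset M := β.support.biUnion fun b => (Set.finite_range b).toFinset
  have h2 : ∀ᶠ s in (U : Filter (Finset M)), T ≤ s :=
    Ultrafilter.of_le atTop (eventually_ge_atTop T)
  obtain ⟨s, hs1, hs2⟩ := (h1.and h2).exists
  obtain ⟨β', hβ', rfl⟩ := exists_compLin_subtype_eq hβ (Substructure.closure L (s : Set M))
    fun b hb x => Substructure.subset_closure
      (hs2 (Finset.mem_biUnion.2 ⟨b, hb, by simp⟩))
  refine hfb s β' hβ' (isBalanced_iff.2 fun a a' => ?_)
  have key : push (F s) (compLin (Finsupp.single (Substructure.closure L (s : Set M)).subtype 1) β')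
      = push (f s) β' := by
    rw [push_compLin]
    congr 1
    funext e
    rw [push_single_one, hFsub]
  have h3 := isBalanced_iff.1 hbal a a'
  have h4 := hs1 a
  have h5 := hs1 a'
  rw [key] at h4 h5
  rw [abs_le] at h3 ⊢
  rw [abs_lt] at h4 h5
  constructor <;> linarith [h3.1, h3.2, h4.1, h4.2, h5.1, h5.2]

/-- Balancing the rounded function balances the function up to `3/4`. -/
theorem balancedArrow_three_quarters {A B C : Type w} [L.Structure A] [L.Structure B]
    [L.Structure C]
    (h : ∀ f : (A ↪[L] C) → Fin 2, ∃ β ∈ convexEmb L C B,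
      IsBalanced (fun e => ((f e : ℕ) : ℝ)) β (1 / 2)) :
    BalancedArrow L C B A (3 / 4) := by
  classical
  intro f hf
  let g : (A ↪[L] C) → Fin 2 := fun e => if f e ≤ 1 / 2 then 0 else 1
  have hg0 : ∀ e, f e ≤ 1 / 2 → g e = 0 := fun e he => if_pos he
  have hg1 : ∀ e, ¬ f e ≤ 1 / 2 → g e = 1 := fun e he => if_neg he
  obtain ⟨β, hβ, hbal⟩ := h g
  refine ⟨β, hβ, isBalanced_iff.2 fun a a' => ?_⟩
  -- Since `g / 2 ≤ f ≤ g / 2 + 1 / 2`, the averages of `f` vary by at most `(1 / 2) * (1 / 2) + 1 /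
  -- 2 = 3 / 4`.
  have h1 : ∀ e, 1 / 2 * ((g e : ℕ) : ℝ) + 0 ≤ f e := by
    intro e
    have := (hf e).1
    by_cases h : f e ≤ 1 / 2
    · simpa [hg0 e h] using this
    · rw [hg1 e h]
      norm_num at h ⊢
      exact h.le
  have h2 : ∀ e, f e ≤ 1 / 2 * ((g e : ℕ) : ℝ) + 1 / 2 := by
    intro e
    have := (hf e).2
    by_cases h : f e ≤ 1 / 2
    · simpa [hg0 e h] using h
    · rw [hg1 e h]
      norm_num
      exact this
  have h3 : ∀ a, 1 / 2 * push (fun e => ((g e : ℕ) : ℝ)) β a + 0 ≤ push f β a := by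
    intro a
    rw [← push_affine _ hβ]
    exact linExt_mono hβ.1 fun _ => h1 _
  have h4 : ∀ a, push f β a ≤ 1 / 2 * push (fun e => ((g e : ℕ) : ℝ)) β a + 1 / 2 := by
    intro a
    rw [← push_affine _ hβ]
    exact linExt_mono hβ.1 fun _ => h2 _
  have h5 := abs_le.1 (isBalanced_iff.1 hbal a a')
  rw [abs_le]
  constructor <;> linarith [h3 a, h3 a', h4 a, h4 a', h5.1, h5.2]

/-- After one stage the function takes values in an interval of length `p`; stretched to `[0, 1]`,
it can be balanced again, and each stage gains a factor `p`. -/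
theorem exists_balancedArrow_pow {M : Type w} [L.Structure M] {A : L.Substructure M} {p : ℝ}
    (hp : 0 < p) (h : ∀ B ∈ Age L M, ∃ C ∈ Age L M, BalancedArrow L C B A p) (n : ℕ) :
    ∀ B ∈ Age L M, ∃ C ∈ Age L M, BalancedArrow L C B A (p ^ n) := by
  induction n with
  | zero =>
    intro B hB
    refine ⟨B, hB, fun f hf => ?_⟩
    have := single_mem_convexEmb (Embedding.refl L B)
    exact ⟨_, this, by simpa using isBalanced_one this hf⟩
  | succ n ih =>
    intro B hB
    obtain ⟨D, hD, hDB⟩ := ih B hB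
    obtain ⟨C, hC, hCD⟩ := h D hD
    refine ⟨C, hC, fun f hf => ?_⟩
    obtain ⟨γ, hγ, hfγ⟩ := hCD f hf
    obtain ⟨c, hc⟩ := exists_forall_mem_Icc_of_abs_sub_le (isBalanced_iff.1 hfγ)
    obtain ⟨β, hβ, hfβ⟩ := hDB (fun e => p⁻¹ * push f γ e + p⁻¹ * -c) fun e => by
      rw [← mul_add]
      constructor
      · have := (hc e).1
        exact mul_nonneg (inv_nonneg.2 hp.le) (by linarith)
      · rw [inv_mul_le_iff₀ hp]
        linarith [(hc e).2]
    refine ⟨compLin γ β, compLin_mem_convexEmb hγ hβ, isBalanced_compLin_iff.2 ?_⟩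
    refine isBalanced_of_affine hβ (inv_pos.2 hp) (d := p⁻¹ * -c) ?_
    rwa [pow_succ, mul_comm (p ^ n), inv_mul_cancel_left₀ hp.ne']

theorem exists_balancedArrow_of_lt_one {M : Type w} [L.Structure M] {p : ℝ} (hp : p < 1)
    (h : ∀ A ∈ Age L M, ∀ B ∈ Age L M, ∃ C ∈ Age L M, BalancedArrow L C B A p)
    {A B : L.Substructure M} (hA : A ∈ Age L M) (hB : B ∈ Age L M) {ε : ℝ} (hε : 0 < ε) :
    ∃ C ∈ Age L M, BalancedArrow L C B A ε := by
  obtain ⟨q, hpq, hq0, hq1⟩ : ∃ q, p ≤ q ∧ 0 < q ∧ q < 1 :=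
    ⟨max p (1 / 2), le_max_left _ _, by positivity, max_lt hp (by norm_num)⟩
  obtain ⟨n, hn⟩ := exists_pow_lt_of_lt_one hε hq1
  obtain ⟨C, hC, hCB⟩ := exists_balancedArrow_pow (A := A) hq0 (fun B hB => by
    obtain ⟨C, hC, hCB⟩ := h A hA B hB
    refine ⟨C, hC, fun f hf => ?_⟩
    obtain ⟨β, hβ, hb⟩ := hCB f hf
    exact ⟨β, hβ, hb.mono hpq⟩) n B hB
  refine ⟨C, hC, fun f hf => ?_⟩
  obtain ⟨β, hβ, hb⟩ := hCB f hf
  exact ⟨β, hβ, hb.mono hn.le⟩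

/-- The outer combination `γ` balances `f 0`, and `β` balances the remaining functions pushed along
`γ`. The error does not accumulate. -/
theorem exists_simultaneously_balanced {M : Type w} [L.Structure M] {A : L.Substructure M}
    {ε : ℝ} (h : ∀ B ∈ Age L M, ∃ C ∈ Age L M, BalancedArrow L C B A ε) (n : ℕ) :
    ∀ B ∈ Age L M, ∃ C ∈ Age L M, ∀ f : Fin n → (A ↪[L] C) → ℝ,
      (∀ i e, f i e ∈ Set.Icc (0 : ℝ) 1) →
        ∃ β ∈ convexEmb L C B, ∀ i, IsBalanced (f i) β ε := by
  induction n with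
  | zero =>
    intro B hB
    exact ⟨B, hB, fun f _ => ⟨_, single_mem_convexEmb (Embedding.refl L B), fun i => i.elim0⟩⟩
  | succ n ih =>
    intro B hB
    obtain ⟨D, hD, hDB⟩ := ih B hB
    obtain ⟨C, hC, hCD⟩ := h D hD
    refine ⟨C, hC, fun f hf => ?_⟩
    obtain ⟨γ, hγ, hfγ⟩ := hCD (f 0) (hf 0)
    obtain ⟨β, hβ, hfβ⟩ := hDB (fun i => push (f i.succ) γ) fun i => push_mem_Icc hγ (hf i.succ)
    refine ⟨compLin γ β, compLin_mem_convexEmb hγ hβ, Fin.cases (hfγ.compLin hβ) fun i => ?_⟩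
    exact isBalanced_compLin_iff.2 (hfβ i)

/-- The arrow relation for two colours passes from a substructure to the whole structure. -/
theorem exists_isBalanced_of_convexArrow {M A B : Type w} [L.Structure M] [L.Structure A]
    [L.Structure B] {C : L.Substructure M} {k : ℕ} (h : ConvexArrow L C B A k)
    (f : (A ↪[L] M) → Fin k) :
    ∃ β ∈ convexEmb L M B, IsBalanced (fun e => ((f e : ℕ) : ℝ)) β (1 / 2) := by
  obtain ⟨β, hβ, hb⟩ := h fun e => f (C.subtype.comp e)
  refine ⟨compLin (Finsupp.single C.subtype 1) β,
    compLin_mem_convexEmb (single_mem_convexEmb _) hβ, isBalanced_compLin_iff.2 ?_⟩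
  convert hb using 1
  funext e
  exact push_single_one _ _ _

theorem BalancedArrow.convexArrow {A B C : Type w} [L.Structure A] [L.Structure B]
    [L.Structure C] (h : BalancedArrow L C B A (1 / 2)) : ConvexArrow L C B A 2 := by
  intro f
  refine h _ fun e => ⟨by positivity, ?_⟩
  exact_mod_cast Nat.le_of_lt_succ (f e).2

end FiniteCombinatorics

/-! ### Invariant measures from almost invariant functionals -/

section InvariantMeasure

open Filter Topology MeasureTheory

variable {G : Type w} [Group G] {K : Type x} [TopologicalSpace K]

/-- The translate of a continuous function by a group element. -/
def translate [MulAction G K] [ContinuousConstSMul G K] (g : G) (h : C(K, ℝ)) : C(K, ℝ) :=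
  h.comp ⟨fun y => g • y, continuous_const_smul g⟩

/-- A positive normalised functional on `C(K)` is represented by a probability measure, which is
invariant if the functional is. -/
theorem exists_invariant_measure_of_functional [CompactSpace K] [T2Space K] [MulAction G K]
    [ContinuousConstSMul G K] [MeasurableSpace K] [BorelSpace K] (Λ : C(K, ℝ) →ₗ[ℝ] ℝ)
    (hpos : ∀ h : C(K, ℝ), 0 ≤ h → 0 ≤ Λ h) (hone : Λ 1 = 1)
    (hinv : ∀ (g : G) h, Λ (translate g h) = Λ h) :
    ∃ μ : Measure K, IsProbabilityMeasure μ ∧ SMulInvariantMeasure G K μ := by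
  let Λ' : CompactlySupportedContinuousMap K ℝ →ₚ[ℝ] ℝ := PositiveLinearMap.mk₀
    { toFun := fun h => Λ h.toContinuousMap
      map_add' := fun h h' => Λ.map_add h.toContinuousMap h'.toContinuousMap
      map_smul' := fun r h => Λ.map_smul r h.toContinuousMap }
    (fun h hh => hpos _ hh)
  let μ := RealRMK.rieszMeasure Λ'
  have hμ : ∀ h : C(K, ℝ), ∫ y, h y ∂μ = Λ h := fun h =>
    RealRMK.integral_rieszMeasure Λ' (CompactlySupportedContinuousMap.continuousMapEquiv h)
  have hreg : μ.Regular := RealRMK.regular_rieszMeasure Λ'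
  have hfin : IsFiniteMeasure μ := CompactSpace.isFiniteMeasure
  refine ⟨μ, ⟨?_⟩, ?_⟩
  · have h1 := hμ 1
    rw [hone] at h1
    simp only [ContinuousMap.one_apply, integral_const, smul_eq_mul, mul_one] at h1
    rw [Measure.real, ENNReal.toReal_eq_one_iff] at h1
    exact h1
  · have hmap : ∀ g : G, Measure.map (fun y => g • y) μ = μ := by
      intro g
      have : (Measure.map (fun y => g • y) μ).Regular := hreg.map (Homeomorph.smul g)
      refine Measure.ext_of_integral_eq_on_compactlySupported fun h => ?_
      rw [integral_map (by fun_prop) (by fun_prop)]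
      exact (hμ (translate g h.toContinuousMap)).trans
        ((hinv g h.toContinuousMap).trans (hμ h.toContinuousMap).symm)
    refine ⟨fun g s hs => ?_⟩
    conv_rhs => rw [← hmap g]
    rw [Measure.map_apply (by fun_prop) hs]

/-- Approximately invariant positive normalised functionals yield an invariant measure. -/
theorem exists_invariant_measure_of_approx [CompactSpace K] [T2Space K] [MulAction G K]
    [ContinuousConstSMul G K] [MeasurableSpace K] [BorelSpace K]
    (H : ∀ (S : Finset C(K, ℝ)) (T : Finset G) (ε : ℝ), 0 < ε → ∃ Λ : C(K, ℝ) →ₗ[ℝ] ℝ,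
      (∀ h, 0 ≤ h → 0 ≤ Λ h) ∧ Λ 1 = 1 ∧ ∀ h ∈ S, ∀ g ∈ T, |Λ (translate g h) - Λ h| ≤ ε) :
    ∃ μ : Measure K, IsProbabilityMeasure μ ∧ SMulInvariantMeasure G K μ := by
  classical
  let ι := Finset C(K, ℝ) × Finset G × ℕ
  have H' : ∀ i : ι, ∃ Λ : C(K, ℝ) →ₗ[ℝ] ℝ, (∀ h, 0 ≤ h → 0 ≤ Λ h) ∧ Λ 1 = 1 ∧
      ∀ h ∈ i.1, ∀ g ∈ i.2.1, |Λ (translate g h) - Λ h| ≤ 1 / ((i.2.2 : ℝ) + 1) :=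
    fun i => H i.1 i.2.1 _ Nat.one_div_pos_of_nat
  choose Λ hpos hone hinv using H'
  -- Positivity and normalisation confine the functionals to a compact product of intervals, so a
  -- pointwise ultralimit exists.
  have hbound : ∀ i h, Λ i h ∈ Set.Icc (-‖h‖) ‖h‖ := by
    intro i h
    have h1 : 0 ≤ Λ i (‖h‖ • 1 - h) := hpos i _ fun y => by
      simpa using (abs_le.1 (h.norm_coe_le_norm y)).2
    have h2 : 0 ≤ Λ i (‖h‖ • 1 + h) := hpos i _ fun y => by
      simpa using by linarith [(abs_le.1 (h.norm_coe_le_norm y)).1]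
    simp only [map_sub, map_add, map_smul, hone, smul_eq_mul, mul_one] at h1 h2
    constructor <;> linarith
  let U : Ultrafilter ι := Ultrafilter.of atTop
  obtain ⟨Λ₀, -, hlim⟩ := (isCompact_univ_pi fun h : C(K, ℝ) =>
    isCompact_Icc (a := -‖h‖) (b := ‖h‖)).ultrafilter_le_nhds' (U.map fun i h => Λ i h)
      (Filter.mem_map.2 (Filter.univ_mem' fun i h _ => hbound i h))
  have hlim : ∀ h, Tendsto (fun i => Λ i h) U (𝓝 (Λ₀ h)) := tendsto_pi_nhds.1 hlim
  let Λ₁ : C(K, ℝ) →ₗ[ℝ] ℝ :=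
    { toFun := Λ₀
      map_add' := fun h h' => tendsto_nhds_unique (hlim (h + h')) (by
        simpa only [map_add] using (hlim h).add (hlim h'))
      map_smul' := fun r h => tendsto_nhds_unique (hlim (r • h)) (by
        simpa only [map_smul, RingHom.id_apply] using (hlim h).const_smul r) }
  refine exists_invariant_measure_of_functional (G := G) Λ₁ (fun h hh => ?_) ?_ fun g h => ?_
  · exact ge_of_tendsto' (hlim h) fun i => hpos i h hh
  · exact tendsto_nhds_unique (hlim 1) (by simp only [hone]; exact tendsto_const_nhds)
  · have h1 : Tendsto (fun i => |Λ i (translate g h) - Λ i h|) U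
        (𝓝 |Λ₀ (translate g h) - Λ₀ h|) := ((hlim _).sub (hlim _)).abs
    have h2 : ∀ n : ℕ, |Λ₀ (translate g h) - Λ₀ h| ≤ 1 / ((n : ℝ) + 1) := by
      intro n
      refine le_of_tendsto h1 (Ultrafilter.of_le atTop ?_)
      filter_upwards [eventually_ge_atTop (({h}, {g}, n) : ι)] with i hi
      refine (hinv i h (hi.1 (by simp)) g (hi.2.1 (by simp))).trans ?_
      exact Nat.one_div_le_one_div hi.2.2
    have h3 : |Λ₀ (translate g h) - Λ₀ h| ≤ 0 :=
      ge_of_tendsto' tendsto_one_div_add_atTop_nhds_zero_nat h2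
    exact sub_eq_zero.1 (abs_nonpos_iff.1 h3)

end InvariantMeasure

/-! ### Balancing implies amenability -/

section RamseyToAmenable

open Filter Topology MeasureTheory

variable {L : FirstOrder.Language.{u, v}} {M : Type w} [L.Structure M]

/-- Neighbourhoods of the identity contain pointwise stabilisers of finite sets. -/
theorem exists_stabilizer_subset {V : Set (M ≃[L] M)} (hV : IsOpen V) (h1 : (1 : M ≃[L] M) ∈ V) :
    ∃ s : Finset M, ∀ g : M ≃[L] M, (∀ m ∈ s, g m = m) → g ∈ V := by
  let _ : TopologicalSpace M := ⊥
  obtain ⟨W, hW, rfl⟩ := isOpen_induced_iff.1 hV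
  obtain ⟨I, t, ht, hI⟩ := isOpen_pi_iff.1 hW _ h1
  refine ⟨I, fun g hg => hI fun m hm => ?_⟩
  change g m ∈ t m
  rw [hg m hm]
  exact (ht m hm).2

/-- A continuous function on a compact `Aut(M)`-space is almost invariant under the stabiliser of
a finite set. -/
theorem exists_forall_abs_smul_sub_le {K : Type x} [TopologicalSpace K] [CompactSpace K]
    [MulAction (M ≃[L] M) K] [ContinuousSMul (M ≃[L] M) K] (h : C(K, ℝ)) {ε : ℝ} (hε : 0 < ε) :
    ∃ s : Finset M, ∀ g : M ≃[L] M, (∀ m ∈ s, g m = m) → ∀ y, |h (g • y) - h y| ≤ ε := by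
  have hopen : IsOpen {p : (M ≃[L] M) × K | |h (p.1 • p.2) - h p.2| < ε} :=
    isOpen_lt (by fun_prop) continuous_const
  -- Compactness of `K` gives one neighbourhood of the identity that serves all `y`.
  obtain ⟨V, W, hV, -, h1, hW, hVW⟩ := generalized_tube_lemma
    (isCompact_singleton (x := (1 : M ≃[L] M))) (isCompact_univ (X := K)) hopen
    (by rintro ⟨g, y⟩ ⟨rfl, -⟩; simpa using hε)
  obtain ⟨s, hs⟩ := exists_stabilizer_subset hV (h1 rfl)
  refine ⟨s, fun g hg y => ?_⟩
  exact (show |h (g • y) - h y| < ε from hVW (Set.mk_mem_prod (hs g hg) (hW trivial))).le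

/-- Simultaneous balancing of bounded functions on the embeddings into `M`. -/
theorem exists_balanced_of_bounded {A B : L.Substructure M} {ε R : ℝ} (hR : 0 < R) {n : ℕ}
    (h : ∃ C ∈ Age L M, ∀ f : Fin n → (A ↪[L] C) → ℝ, (∀ i e, f i e ∈ Set.Icc (0 : ℝ) 1) →
        ∃ β ∈ convexEmb L C B, ∀ i, IsBalanced (f i) β ((2 * R)⁻¹ * ε))
    (f : Fin n → (A ↪[L] M) → ℝ) (hf : ∀ i e, |f i e| ≤ R) :
    ∃ β ∈ convexEmb L M B, ∀ i, IsBalanced (f i) β ε := by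
  obtain ⟨C, -, hC⟩ := h
  -- This affine map carries `[-R, R]` onto `[0, 1]`.
  obtain ⟨β, hβ, hb⟩ := hC (fun i e => (2 * R)⁻¹ * f i (C.subtype.comp e) + 1 / 2) fun i e => by
    have h1 := abs_le.1 (hf i (C.subtype.comp e))
    have h2 : (2 * R)⁻¹ * R = 1 / 2 := by field_simp
    have h3 : 0 < (2 * R)⁻¹ := by positivity
    constructor <;> nlinarith
  refine ⟨compLin (Finsupp.single C.subtype 1) β,
    compLin_mem_convexEmb (single_mem_convexEmb _) hβ, fun i => isBalanced_compLin_iff.2 ?_⟩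
  refine isBalanced_of_affine hβ (c := (2 * R)⁻¹) (d := 1 / 2) (by positivity) ?_
  convert hb i using 4
  exact push_single_one _ _ _

theorem exists_extension (hM : L.IsUltrahomogeneous M) [L.IsRelational] {A : L.Substructure M}
    (hA : A ∈ Age L M) (e : A ↪[L] M) : ∃ g : M ≃[L] M, ∀ a : A, g a = e a := by
  obtain ⟨g, hg⟩ := hM A (Substructure.fg_iff_finite.2 hA.to_subtype) e
  exact ⟨g, fun a => (DFunLike.congr_fun hg a).symm⟩

/-- Balancing finitely many functions simultaneously makes the automorphism group amenable. -/
theorem isAmenable_of_balanced (hM : L.IsUltrahomogeneous M) [L.IsRelational]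
    (H : ∀ A ∈ Age L M, ∀ B ∈ Age L M, ∀ ε : ℝ, 0 < ε → ∀ n : ℕ,
        ∃ C ∈ Age L M,
          ∀ f : Fin n → (A ↪[L] C) → ℝ, (∀ i e, f i e ∈ Set.Icc (0 : ℝ) 1) →
            ∃ β ∈ convexEmb L C B, ∀ i, IsBalanced (f i) β ε) :
    IsAmenable.{w, x} (M ≃[L] M) := by
  classical
  intro K _ _ _ _ _ _ _ _
  refine exists_invariant_measure_of_approx fun S T ε hε => ?_
  have hε3 : 0 < ε / 3 := by positivity
  choose s hs using fun h : C(K, ℝ) => exists_forall_abs_smul_sub_le (L := L) (M := M) h hε3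
  let A₀ : Finset M := S.biUnion s
  let A : L.Substructure M := Substructure.closure L A₀
  have hA : A ∈ Age L M := Age.closure_mem A₀.finite_toSet
  have hAmem : ∀ a : A, (a : M) ∈ A₀ := fun a =>
    (Substructure.mem_closure_iff_of_isRelational L (A₀ : Set M) a).1 a.2
  -- With the identity included, the untranslated functional is the case `g = 1` of `hΛ`.
  let T' : Finset (M ≃[L] M) := insert 1 T
  let B₀ : Finset M := T'.biUnion fun g => A₀.image fun m => g⁻¹ m
  let B : L.Substructure M := Substructure.closure L B₀
  have hB : B ∈ Age L M := Age.closure_mem B₀.finite_toSet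
  have hmove : ∀ g ∈ T', ∀ a : A, (g⁻¹.toEmbedding.comp A.subtype) a ∈ B := fun g hg a =>
    Substructure.subset_closure (Finset.mem_biUnion.2
      ⟨g, hg, Finset.mem_image_of_mem _ (hAmem a)⟩)
  choose E hE using fun e : A ↪[L] M => exists_extension hM hA e
  choose EB hEB using fun e : B ↪[L] M => exists_extension hM hB e
  obtain ⟨y₀⟩ := ‹Nonempty K›
  let R : ℝ := 1 + ∑ h ∈ S, ‖h‖
  have hR : 0 < R := by positivity
  have hSR : ∀ h ∈ S, ‖h‖ ≤ R := fun h hh => by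
    have := Finset.single_le_sum (f := fun h : C(K, ℝ) => ‖h‖) (fun _ _ => norm_nonneg _) hh
    simp only [R]
    linarith
  obtain ⟨β, hβ, hbal⟩ := exists_balanced_of_bounded hR
    (H A hA B hB ((2 * R)⁻¹ * (ε / 3)) (by positivity) S.card)
    (fun i e => (S.equivFin.symm i).1 ((E e)⁻¹ • y₀))
    (fun i e => ((S.equivFin.symm i).1.norm_coe_le_norm _).trans (hSR _ (S.equivFin.symm i).2))
  have hbal : ∀ h ∈ S, IsBalanced (fun e => h ((E e)⁻¹ • y₀)) β (ε / 3) := by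
    intro h hh
    simpa using hbal (S.equivFin ⟨h, hh⟩)
  let Λ : C(K, ℝ) →ₗ[ℝ] ℝ :=
    { toFun := fun h => linExt (fun b => h ((EB b)⁻¹ • y₀)) β
      map_add' := fun h h' => by
        simp only [linExt_eq_sum, ContinuousMap.add_apply, mul_add, Finset.sum_add_distrib]
      map_smul' := fun r h => by
        simp only [linExt_eq_sum, ContinuousMap.smul_apply, smul_eq_mul, Finset.mul_sum,
          RingHom.id_apply, mul_left_comm] }
  have hΛ : ∀ h ∈ S, ∀ g (hg : g ∈ T'), |Λ (translate g h) -
      push (fun e => h ((E e)⁻¹ • y₀)) β (Embedding.codRestrict B _ (hmove g hg))| ≤ ε / 3 := by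
    intro h hh g hg
    refine abs_linExt_sub_le hβ fun b => ?_
    set e : A ↪[L] M := b.comp (Embedding.codRestrict B _ (hmove g hg)) with he
    -- On `A`, the map `E e` agrees with `EB b * g⁻¹`, so `g * (EB b)⁻¹` and `(E e)⁻¹` differ by an
    -- element stabilising `s h`, which hardly changes `h`.
    have hfix : ∀ m ∈ s h, (g * (EB b)⁻¹ * E e) m = m := by
      intro m hm
      have hmA : m ∈ A := Substructure.subset_closure (Finset.mem_biUnion.2 ⟨h, hh, hm⟩)
      have h1 : E e m = EB b (g⁻¹ m) := (hE e ⟨m, hmA⟩).trans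
        (hEB b (Embedding.codRestrict B _ (hmove g hg) ⟨m, hmA⟩)).symm
      rw [aut_mul_apply, aut_mul_apply, h1, (aut_inv_apply_eq_iff (EB b) _ (g⁻¹ m)).2 rfl]
      exact (aut_inv_apply_eq_iff g⁻¹ _ _).2 rfl
    have h2 := hs h _ hfix ((E e)⁻¹ • y₀)
    rw [← mul_smul, mul_assoc, mul_inv_cancel, mul_one, mul_smul] at h2
    exact h2
  refine ⟨Λ, fun h hh => ?_, linExt_const hβ 1, fun h hh g hg => ?_⟩
  · exact (linExt_const hβ 0).symm.trans_le (linExt_mono hβ.1 fun b => hh _)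
  · have hg' : g ∈ T' := Finset.mem_insert_of_mem hg
    have h1' : (1 : M ≃[L] M) ∈ T' := Finset.mem_insert_self _ _
    have h1 := abs_le.1 (hΛ h hh g hg')
    have h2 := abs_le.1 (hΛ h hh 1 h1')
    have h3 := abs_le.1 (isBalanced_iff.1 (hbal h hh)
      (Embedding.codRestrict B _ (hmove g hg')) (Embedding.codRestrict B _ (hmove 1 h1')))
    have h4 : translate (1 : M ≃[L] M) h = h := by
      ext y
      exact congrArg h (one_smul _ y)
    rw [h4] at h2
    rw [abs_le]
    constructor <;> linarith [h1.1, h1.2, h2.1, h2.2, h3.1, h3.2]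

end RamseyToAmenable

/-! ### Amenability implies balancing, via orbit closures -/

section AmenableToRamsey

open Filter Topology MeasureTheory

/-- Amenability, tested on spaces in one universe, applies to all spaces that are small with
respect to that universe. -/
theorem IsAmenable.exists_measure_of_small {G : Type w} [Group G] [TopologicalSpace G]
    [IsTopologicalGroup G] (hG : IsAmenable.{w, x} G) (K : Type v) [Small.{x} K]
    [TopologicalSpace K] [CompactSpace K] [T2Space K] [Nonempty K] [MulAction G K]
    [ContinuousSMul G K] [MeasurableSpace K] [BorelSpace K] :
    ∃ μ : Measure K, IsProbabilityMeasure μ ∧ SMulInvariantMeasure G K μ := by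
  let φ : K ≃ₜ Shrink.{x} K := Shrink.homeomorph K
  have hsmul : ∀ (g : G) (y : Shrink.{x} K), φ.symm (g • y) = g • φ.symm y :=
    fun g y => φ.symm_apply_apply _
  have : ContinuousSMul G (Shrink.{x} K) := ⟨by
    rw [← φ.symm.comp_continuous_iff]
    change Continuous fun p : G × Shrink.{x} K => φ.symm (p.1 • p.2)
    simp only [hsmul]
    exact continuous_fst.smul (φ.symm.continuous.comp continuous_snd)⟩
  have : CompactSpace (Shrink.{x} K) := φ.compactSpace
  have : T2Space (Shrink.{x} K) := φ.t2Space
  have : Nonempty (Shrink.{x} K) := φ.toEquiv.symm.nonempty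
  let _ : MeasurableSpace (Shrink.{x} K) := borel _
  have : BorelSpace (Shrink.{x} K) := ⟨rfl⟩
  obtain ⟨μ, hμ, hinv⟩ := hG (Shrink.{x} K)
  have hφ : Measurable φ.symm := φ.symm.continuous.measurable
  refine ⟨μ.map φ.symm, Measure.isProbabilityMeasure_map hφ.aemeasurable, ⟨fun g s hs => ?_⟩⟩
  rw [Measure.map_apply hφ hs, Measure.map_apply hφ ((continuous_const_smul g).measurable hs),
    ← measure_preimage_smul_of_nullMeasurableSet (hφ hs).nullMeasurableSet g]
  congr 1
  ext y
  simp [hsmul]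

variable {L : FirstOrder.Language.{u, v}} {M : Type w} [L.Structure M]

theorem push_add {A B C : Type w} [L.Structure A] [L.Structure B] [L.Structure C]
    (f : (A ↪[L] C) → ℝ) (β β' : (B ↪[L] C) →₀ ℝ) :
    push f (β + β') = push f β + push f β' :=
  funext fun _ => linExt_add _ _ _

theorem push_smul {A B C : Type w} [L.Structure A] [L.Structure B] [L.Structure C]
    (f : (A ↪[L] C) → ℝ) (r : ℝ) (β : (B ↪[L] C) →₀ ℝ) :
    push f (r • β) = r • push f β :=
  funext fun _ => linExt_smul _ _ _

/-- The translates of a real function on embeddings, for the action of `Aut(M)`. -/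
def embTranslate {A : Type w} [L.Structure A] (g : M ≃[L] M) (f : (A ↪[L] M) → ℝ)
    (e : A ↪[L] M) : ℝ :=
  f (g⁻¹.toEmbedding.comp e)

theorem continuous_embTranslate {A : Type w} [L.Structure A] (g : M ≃[L] M) :
    Continuous (embTranslate g : ((A ↪[L] M) → ℝ) → (A ↪[L] M) → ℝ) :=
  continuous_pi fun _ => continuous_apply _

/-- As `A` is finite, `g⁻¹ ∘ e` is locally constant in `g`; near `g₀` each coordinate is therefore
evaluation at a fixed embedding. -/
theorem continuous_embTranslate_uncurry {A : Type w} [L.Structure A] [Finite A] :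
    Continuous fun p : (M ≃[L] M) × ((A ↪[L] M) → ℝ) => embTranslate p.1 p.2 := by
  refine continuous_pi fun e => continuous_iff_continuousAt.2 fun ⟨g₀, k₀⟩ => ?_
  have hev : ∀ᶠ g in 𝓝 g₀, g⁻¹.toEmbedding.comp e = g₀⁻¹.toEmbedding.comp e := by
    have : ∀ᶠ g in 𝓝 g₀, ∀ a, g (g₀⁻¹ (e a)) = e a :=
      Filter.eventually_all.2 fun a => (aut_isOpen_apply_eq _ _).mem_nhds
        ((aut_inv_apply_eq_iff g₀ (e a) _).1 rfl)
    filter_upwards [this] with g hg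
    ext a
    exact (aut_inv_apply_eq_iff g (e a) _).2 (hg a)
  have hc : Continuous fun p : (M ≃[L] M) × ((A ↪[L] M) → ℝ) =>
      p.2 (g₀⁻¹.toEmbedding.comp e) := (continuous_apply _).comp continuous_snd
  refine hc.continuousAt.congr ?_
  have := (continuous_fst (X := M ≃[L] M) (Y := (A ↪[L] M) → ℝ)).tendsto (g₀, k₀)
  filter_upwards [this.eventually hev] with p hp
  exact congrArg p.2 hp.symm

/-- The closure of the orbit of a real function on embeddings. -/
def orbitClosure {A : Type w} [L.Structure A] (f : (A ↪[L] M) → ℝ) : Set ((A ↪[L] M) → ℝ) :=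
  closure (Set.range fun g : M ≃[L] M => embTranslate g f)

theorem embTranslate_mem_orbitClosure {A : Type w} [L.Structure A] {f : (A ↪[L] M) → ℝ}
    (g : M ≃[L] M) {k : (A ↪[L] M) → ℝ} (hk : k ∈ orbitClosure f) :
    embTranslate g k ∈ orbitClosure f := by
  refine map_mem_closure (continuous_embTranslate g) hk ?_
  rintro _ ⟨g', rfl⟩
  exact ⟨g * g', rfl⟩

instance {A : Type w} [L.Structure A] (f : (A ↪[L] M) → ℝ) :
    MulAction (M ≃[L] M) (orbitClosure f) where
  smul g k := ⟨embTranslate g k.1, embTranslate_mem_orbitClosure g k.2⟩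
  one_smul _ := rfl
  mul_smul _ _ _ := rfl

instance {A : Type w} [L.Structure A] [Finite A] (f : (A ↪[L] M) → ℝ) :
    ContinuousSMul (M ≃[L] M) (orbitClosure f) :=
  ⟨Continuous.subtype_mk (continuous_embTranslate_uncurry.comp
    (continuous_fst.prodMk (continuous_subtype_val.comp continuous_snd))) _⟩

theorem isCompact_orbitClosure {A : Type w} [L.Structure A] {f : (A ↪[L] M) → ℝ} {c d : ℝ}
    (hf : ∀ e, f e ∈ Set.Icc c d) : IsCompact (orbitClosure f) := by
  refine (isCompact_univ_pi fun _ => isCompact_Icc (a := c) (b := d)).closure_of_subset ?_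
  rintro _ ⟨g, rfl⟩ e -
  exact hf _

/-- Amenability of the automorphism group makes bounded functions on embeddings balanced up to any
positive error. -/
theorem balancedArrow_of_isAmenable [L.IsRelational] [Countable M]
    (hM : L.IsUltrahomogeneous M) (hG : IsAmenable.{w, x} (M ≃[L] M)) {A B : L.Substructure M}
    (hA : A ∈ Age L M) (hB : B ∈ Age L M) {ε : ℝ} (hε : 0 < ε) : BalancedArrow L M B A ε := by
  intro f hf
  have : Finite A := hA.to_subtype
  have : Finite B := hB.to_subtype
  have : Finite (A ↪[L] B) := finite_embedding A B
  have : Fintype (A ↪[L] B) := Fintype.ofFinite _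
  -- Countability makes the orbit closure small in every universe, as `exists_measure_of_small`
  -- requires.
  have : Countable (A ↪[L] M) :=
    Function.Injective.countable (f := fun e : A ↪[L] M => (e : A → M)) DFunLike.coe_injective
  have : CompactSpace (orbitClosure f) := isCompact_iff_compactSpace.1 (isCompact_orbitClosure hf)
  have : Nonempty (orbitClosure f) := ⟨f, subset_closure ⟨1, rfl⟩⟩
  let _ : MeasurableSpace (orbitClosure f) := borel _
  have : BorelSpace (orbitClosure f) := ⟨rfl⟩
  obtain ⟨μ, hμ, hinv⟩ := hG.exists_measure_of_small (orbitClosure f)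
  have hconst : ∀ e : A ↪[L] M, ∫ k : orbitClosure f, k.1 e ∂μ
      = ∫ k : orbitClosure f, k.1 A.subtype ∂μ := by
    intro e
    obtain ⟨g, hg⟩ := exists_extension hM hA e
    rw [← integral_smul_eq_self (μ := μ) (fun k : orbitClosure f => k.1 e) (g := g)]
    have : g⁻¹.toEmbedding.comp e = A.subtype := by
      ext a
      exact (aut_inv_apply_eq_iff g (e a) _).2 (hg a)
    change ∫ k : orbitClosure f, k.1 (g⁻¹.toEmbedding.comp e) ∂μ = _
    rw [this]
  let r : ((A ↪[L] M) → ℝ) → (A ↪[L] B) → ℝ := fun k a => k (B.subtype.comp a)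
  have hr : Continuous r := continuous_pi fun _ => continuous_apply _
  let S : Set ((A ↪[L] B) → ℝ) := push f '' convexEmb L M B
  have hS : Convex ℝ S := by
    rintro _ ⟨β, hβ, rfl⟩ _ ⟨β', hβ', rfl⟩ s t hs ht hst
    exact ⟨_, convex_convexEmb hβ hβ' hs ht hst, by rw [push_add, push_smul, push_smul]⟩
  -- For `k` in the orbit, `r k` is `push f` of the single embedding `g⁻¹` restricted to `B`;
  -- continuity of `r` extends this to the closure.
  have hrS : ∀ k : orbitClosure f, r k.1 ∈ closure S := by
    rintro ⟨k, hk⟩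
    refine map_mem_closure hr hk ?_
    rintro _ ⟨g, rfl⟩
    exact ⟨_, single_mem_convexEmb (g⁻¹.toEmbedding.comp B.subtype),
      funext fun a => push_single_one _ _ _⟩
  have hcont : Continuous fun k : orbitClosure f => r k.1 := hr.comp continuous_subtype_val
  have hint : Integrable (fun k : orbitClosure f => r k.1) μ :=
    hcont.integrable_of_hasCompactSupport (HasCompactSupport.of_compactSpace _)
  -- The barycentre of a probability measure on a closed convex set lies in that set.
  have hmem := hS.closure.integral_mem isClosed_closure (Filter.Eventually.of_forall hrS) hint
  obtain ⟨_, ⟨β, hβ, rfl⟩, hd⟩ := Metric.mem_closure_iff.1 hmem (ε / 2) (by positivity)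
  refine ⟨β, hβ, isBalanced_iff.2 fun a a' => ?_⟩
  have key : ∀ a, |∫ k : orbitClosure f, k.1 A.subtype ∂μ - push f β a| < ε / 2 := by
    intro a
    have h1 := (dist_le_pi_dist _ _ a).trans_lt hd
    rwa [eval_integral fun a => hint.eval a, hconst, Real.dist_eq] at h1
  have h1 := abs_lt.1 (key a)
  have h2 := abs_lt.1 (key a')
  rw [abs_le]
  constructor <;> linarith [h1.1, h1.2, h2.1, h2.2]

end AmenableToRamsey

end ConvexRamsey

/-! ### The equivalences -/

theorem theorem5p1 {L : FirstOrder.Language.{u, v}} [L.IsRelational]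
    {M : Type w} [L.Structure M] [Countable M] (hM : L.IsUltrahomogeneous M) :
    List.TFAE [
      -- colourings of the embeddings into the infinite structure
      ∀ A ∈ ConvexRamsey.Age L M, ∀ B ∈ ConvexRamsey.Age L M, ∀ f : (A ↪[L] M) → Fin 2,
        ∃ β ∈ ConvexRamsey.convexEmb L M B,
          ConvexRamsey.IsBalanced (fun e => ((f e : ℕ) : ℝ)) β (1 / 2),
      ConvexRamsey.ConvexRamseyProperty L M,
      ∃ p : ℝ, p < 1 ∧
        ∀ A ∈ ConvexRamsey.Age L M, ∀ B ∈ ConvexRamsey.Age L M, ∃ C ∈ ConvexRamsey.Age L M,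
          ∀ f : (A ↪[L] C) → ℝ, (∀ e, f e ∈ Set.Icc (0 : ℝ) 1) →
            ∃ β ∈ ConvexRamsey.convexEmb L C B, ConvexRamsey.IsBalanced f β p,
      ∀ A ∈ ConvexRamsey.Age L M, ∀ B ∈ ConvexRamsey.Age L M, ∀ ε : ℝ, 0 < ε →
        ∃ C ∈ ConvexRamsey.Age L M,
          ∀ f : (A ↪[L] C) → ℝ, (∀ e, f e ∈ Set.Icc (0 : ℝ) 1) →
            ∃ β ∈ ConvexRamsey.convexEmb L C B, ConvexRamsey.IsBalanced f β ε,
      ∀ A ∈ ConvexRamsey.Age L M, ∀ B ∈ ConvexRamsey.Age L M, ∀ ε : ℝ, 0 < ε → ∀ n : ℕ,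
        ∃ C ∈ ConvexRamsey.Age L M,
          ∀ f : Fin n → (A ↪[L] C) → ℝ, (∀ i e, f i e ∈ Set.Icc (0 : ℝ) 1) →
            ∃ β ∈ ConvexRamsey.convexEmb L C B, ∀ i, ConvexRamsey.IsBalanced (f i) β ε,
      ConvexRamsey.IsAmenable.{w, x} (M ≃[L] M)] := by
  tfae_have 1 → 3 := by
    intro h
    -- Any number strictly between `3 / 4`, the rounding bound, and 1 works; the compactness step
    -- needs the slack.
    refine ⟨7 / 8, by norm_num, fun A hA B hB => ?_⟩
    have : Finite A := hA.to_subtype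
    have : Finite B := hB.to_subtype
    exact ConvexRamsey.exists_balancedArrow_of_lt (by norm_num)
      (ConvexRamsey.balancedArrow_three_quarters (h A hA B hB))
  tfae_have 3 → 4 := fun ⟨p, hp, h⟩ A hA B hB ε hε =>
    ConvexRamsey.exists_balancedArrow_of_lt_one hp h hA hB hε
  tfae_have 4 → 5 := fun h A hA B hB ε hε n =>
    ConvexRamsey.exists_simultaneously_balanced (fun B hB => h A hA B hB ε hε) n B hB
  tfae_have 5 → 6 := ConvexRamsey.isAmenable_of_balanced hM
  tfae_have 6 → 1 := fun h A hA B hB =>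
    (ConvexRamsey.balancedArrow_of_isAmenable hM h hA hB (by norm_num)).convexArrow
  tfae_have 4 → 2 := fun h A hA B hB => by
    obtain ⟨C, hC, hCB⟩ := h A hA B hB (1 / 2) (by norm_num)
    exact ⟨C, hC, ConvexRamsey.BalancedArrow.convexArrow hCB⟩
  tfae_have 2 → 1 := fun h A hA B hB f => by
    obtain ⟨C, -, hCB⟩ := h A hA B hB
    exact ConvexRamsey.exists_isBalanced_of_convexArrow hCB f
  tfae_finish
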